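/- Let $\mathcal X,\mathcal Y$ be measurable spaces. A (randomized) mechanism $M$ is a Markov kernel from $\mathcal X$ to $\mathcal Y$; $M(x)$ denotes a random variable with the law that the kernel assigns to $x$. Let $\mathcal P$ be a set of probability distributions on $\mathcal X$, and let $\log$ be the base-2 logarithm. For $\mu\in[0,\infty]$, $M$ satisfies $\mu$-CI-LMIP if $\sup_{P_X\in\mathcal P} I(X;M(X))\le\mu$ bits, where $X\sim P_X$. $M$ satisfies $(\epsilon,\delta)$-LDP if $\Pr[M(x)\in E]\le e^{\epsilon}\Pr[M(x')\in E]+\delta$ for all $x,x'\in\mathcal X$ and all measurable $E\subseteq\mathcal Y$. For $\epsilon_0,\epsilon_1\in[0,1]$ let $C_{\mathrm{BAC}}(\epsilon_0,\epsilon_1)$ be the capacity in bits (the supremum of the mutual information over binary input distributions) of the binary asymmetric channel that flips the input $0$ with probability $\epsilon_0$ and the input $1$ with probability $\epsilon_1$. With $H_b(p)=-p\log p-(1-p)\log(1-p)$ it has the following closed form. If $\epsilon_0\le\min\{\epsilon_1,1-\epsilon_1,1/2\}$ and $\epsilon_0+\epsilon_1\ne1$, then $$C_{\mathrm{BAC}}(\epsilon_0,\epsilon_1)=\tfrac{\epsilon_0}{1-\epsilon_0-\epsilon_1}H_b(\epsilon_1)-\tfrac{1-\epsilon_1}{1-\epsilon_0-\epsilon_1}H_b(\epsilon_0)+\log\Big(1+2^{\frac{H_b(\epsilon_0)-H_b(\epsilon_1)}{1-\epsilon_0-\epsilon_1}}\Big).$$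 If $\epsilon_0+\epsilon_1=1$, then $C_{\mathrm{BAC}}(\epsilon_0,\epsilon_1)=0$. Further, $C_{\mathrm{BAC}}(\epsilon_0,\epsilon_1)$ equals $C_{\mathrm{BAC}}(\epsilon_1,\epsilon_0)$ if $\epsilon_0>\epsilon_1$, equals $C_{\mathrm{BAC}}(1-\epsilon_1,1-\epsilon_0)$ if $\epsilon_0>1-\epsilon_1$, and equals $C_{\mathrm{BAC}}(1-\epsilon_0,1-\epsilon_1)$ if $\epsilon_0>1/2$. (a) For $\mu\in[0,\infty]$ and $\epsilon>0$, the maximum $$\delta^{\mathrm{LDP}}_\mu(\epsilon)=\max\big\{\max\{0,\,p_0-e^{\epsilon}p_1,\,p_1-e^{\epsilon}p_0\}\,:\,p_0,p_1\in[0,1],\ C_{\mathrm{BAC}}(p_0,1-p_1)\le\mu\big\}$$ is attained. If $\mathcal P$ contains all distributions of the form $t\,\delta_x+(1-t)\,\delta_{x'}$ with $x,x'\in\mathcal X$, $t\in[0,1]$ (for instance, if $\mathcal P$ is the set of all distributions on $\mathcal X$), then every mechanism that satisfies $\mu$-CI-LMIP satisfies $(\epsilon,\delta^{\mathrm{LDP}}_\mu(\epsilon))$-LDP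 for every $\epsilon>0$. This is tight. Let $A\subset\mathcal X$ be measurable with $A$ and its complement non-empty, and let $\epsilon>0$. Then there is a maximizing pair $(p_0,p_1)$ such that the mechanism with output in $\{0,1\}$ which draws from $\mathrm{Ber}(p_1)$ if $x\in A$ and from $\mathrm{Ber}(p_0)$ otherwise satisfies $\mu$-CI-LMIP, and satisfies $(\epsilon,\delta)$-LDP if and only if $\delta\ge\delta^{\mathrm{LDP}}_\mu(\epsilon)$. In particular, it does not satisfy $(\epsilon,\delta)$-LDP for any $\delta<\delta^{\mathrm{LDP}}_\mu(\epsilon)$. (b) Conversely, if $M$ satisfies $(\epsilon,\delta(\epsilon))$-LDP for all $\epsilon>0$, then, for every $\mathcal P$, $M$ satisfies $\mu$-CI-LMIP with $$\mu=\log(e)\int_0^\infty(1+e^{-\epsilon})\,\delta(\epsilon)\,d\epsilon\in[0,\infty].$$ -/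

import Mathlib

open MeasureTheory ProbabilityTheory InformationTheory unitInterval
open scoped ENNReal

namespace LocalPrivacy

noncomputable section

variable {X Y : Type*} [MeasurableSpace X] [MeasurableSpace Y]

/-- The mutual information `I(x; M(x))`, in bits, between an input `x ∼ P` and the output of the
mechanism `M` (a kernel, `M x` being the law of the output on input `x`): the Kullback-Leibler
divergence between the joint law and the product of its marginals. Mathlib's `klDiv` is in nats. -/
def mutualInfo (P : Measure X) (M : Kernel X Y) : ℝ≥0∞ :=
  klDiv (P ⊗ₘ M) (P.prod (M ∘ₘ P)) / ENNReal.ofReal (Real.log 2)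

/-- Context-independent local mutual-information privacy: the supremum of `I(x; M(x))` over the
space `𝓓` of data distributions is at most `μ` bits. -/
def IsCILMIP (𝓓 : Set (ProbabilityMeasure X)) (μ : ℝ≥0∞) (M : Kernel X Y) : Prop :=
  (⨆ P ∈ 𝓓, mutualInfo (P : Measure X) M) ≤ μ

/-- `(ε, δ)`-local differential privacy. -/
def IsLDP (ε δ : ℝ) (M : Kernel X Y) : Prop :=
  ∀ x x' : X, ∀ E : Set Y, MeasurableSet E →
    (M x).real E ≤ Real.exp ε * (M x').real E + δ

/-- The set of data distributions contains every distribution `t δ_x + (1 - t) δ_{x'}` carried by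
at most two data points. -/
def ContainsTwoPoint (𝓓 : Set (ProbabilityMeasure X)) : Prop :=
  ∀ (x x' : X) (t : I) (P : ProbabilityMeasure X),
    (P : Measure X) = bernoulliMeasure x x' t → P ∈ 𝓓

/-- The Bernoulli distribution with parameter `p` on `Bool`; `true` plays the role of `1`. -/
def ber (p : I) : Measure Bool := bernoulliMeasure true false p

/-- The binary asymmetric channel with crossover probabilities `ε₀` (input `0` is flipped) and
`ε₁` (input `1` is flipped). -/
def bac (ε₀ ε₁ : I) : Kernel Bool Bool :=
  Kernel.ofFunOfCountable fun b => if b then ber (σ ε₁) else ber ε₀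

/-- The capacity, in bits, of the binary asymmetric channel. -/
def bacCapacity (ε₀ ε₁ : I) : ℝ≥0∞ :=
  ⨆ P : ProbabilityMeasure Bool, mutualInfo (P : Measure Bool) (bac ε₀ ε₁)

/-- Binary entropy in bits. -/
def binEntropyBits (p : ℝ) : ℝ :=
  -p * Real.logb 2 p - (1 - p) * Real.logb 2 (1 - p)

/-- The closed form for the capacity of the binary asymmetric channel; meant for `a + b ≠ 1`. -/
def bacFormula (a b : ℝ) : ℝ :=
  a / (1 - a - b) * binEntropyBits b - (1 - b) / (1 - a - b) * binEntropyBits a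
    + Real.logb 2 (1 + 2 ^ ((binEntropyBits a - binEntropyBits b) / (1 - a - b)))

/-- The objective `max {0, p₀ - e^ε p₁, p₁ - e^ε p₀}`. -/
def ldpObjective (ε : ℝ) (p₀ p₁ : I) : ℝ :=
  max 0 (max ((p₀ : ℝ) - Real.exp ε * p₁) ((p₁ : ℝ) - Real.exp ε * p₀))

/-- The values of the objective over the pairs with `C_BAC(p₀, 1 - p₁) ≤ μ`. -/
def ldpValues (μ : ℝ≥0∞) (ε : ℝ) : Set ℝ :=
  {d | ∃ p₀ p₁ : I, bacCapacity p₀ (σ p₁) ≤ μ ∧ d = ldpObjective ε p₀ p₁}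

/-- `δ^LDP_μ(ε)`. -/
def deltaLDP (μ : ℝ≥0∞) (ε : ℝ) : ℝ := sSup (ldpValues μ ε)

open scoped Classical in
/-- The two-output mechanism with law `Ber(p₁)` on inputs in `A` and `Ber(p₀)` on the others. -/
def berMechanism {A : Set X} (hA : MeasurableSet A) (p₀ p₁ : I) :
    Kernel X Bool :=
  Kernel.piecewise hA (Kernel.const X (ber p₁)) (Kernel.const X (ber p₀))

/-- `log₂(e) ∫_0^∞ (1 + e^{-ε}) δ(ε) dε`, possibly infinite. -/
def muCI (δ : ℝ → ℝ) : ℝ≥0∞ :=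
  ENNReal.ofReal (Real.logb 2 (Real.exp 1)) *
    ∫⁻ ε in Set.Ioi (0 : ℝ), ENNReal.ofReal ((1 + Real.exp (-ε)) * δ ε)

end

end LocalPrivacy
/-!
Writing the divergence between Bernoulli distributions as cross entropy minus entropy, where the
cross entropy is affine in its first argument, turns the mutual information of a kernel into `Bool`
into an entropy defect `H(∫ p dP) - ∫ H(p) dP`. For the binary asymmetric channel this is, as a
function of the output distribution, the entropy plus an affine function, and Gibbs' inequality
against `Ber(sigmoid c)` maximizes it, `c` being the slope of that affine function.

For the conversion to LDP, an event `E` and two inputs `x, x'` turn the mechanism into a binary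
asymmetric channel, whose capacity is bounded by data processing. The maximum is attained since the
capacity is lower semicontinuous, as a supremum of continuous functions. A maximizing pair yields
the tight mechanism.

For the converse, `klFun r` is at most the integral over `ε > 0` of
`(r - e^ε)⁺ + e^{-ε} (1 - e^ε r)⁺`. For `r` the likelihood ratio of the joint law and the product of
its marginals, these two terms integrate to hockey-stick divergences, which LDP bounds by `δ(ε)`.
-/

namespace LocalPrivacy

section Divergence

lemma klDiv_compProd_eq_lintegral {X Y : Type*} [MeasurableSpace X] [MeasurableSpace Y]
    [MeasurableSpace.CountableOrCountablyGenerated X Y] (P : Measure X) [IsFiniteMeasure P]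
    (κ η : Kernel X Y) [IsFiniteKernel κ] [IsFiniteKernel η] :
    klDiv (P ⊗ₘ κ) (P ⊗ₘ η) = ∫⁻ x, klDiv (κ x) (η x) ∂P := by
  by_cases hac : ∀ᵐ x ∂P, κ x ≪ η x
  · have hκη : κ =ᵐ[P] η.withDensity (κ.rnDeriv η) := by
      filter_upwards [hac] with x hx using (Kernel.withDensity_rnDeriv_eq hx).symm
    have hjoint : P ⊗ₘ κ = (P ⊗ₘ η).withDensity fun z => κ.rnDeriv η z.1 z.2 := by
      rw [Measure.compProd_congr hκη, Measure.compProd_withDensity (by fun_prop)]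
    have hrn : (P ⊗ₘ κ).rnDeriv (P ⊗ₘ η) =ᵐ[P ⊗ₘ η] fun z => κ.rnDeriv η z.1 z.2 := by
      rw [hjoint]
      exact Measure.rnDeriv_withDensity _ (by fun_prop)
    rw [klDiv_eq_lintegral_klFun_of_ac (Measure.absolutelyContinuous_compProd_right_iff.2 hac),
      lintegral_congr_ae (hrn.mono fun z hz => by rw [hz]),
      Measure.lintegral_compProd (by fun_prop)]
    refine lintegral_congr_ae ?_
    filter_upwards [hac] with x hx
    rw [klDiv_eq_lintegral_klFun_of_ac hx]
    refine lintegral_congr_ae ?_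
    filter_upwards [Kernel.rnDeriv_eq_rnDeriv_measure (κ := κ) (η := η)] with y hy
    rw [hy]
  · have hmeas : MeasurableSet {x | ¬κ x ≪ η x} :=
      (Kernel.measurableSet_absolutelyContinuous κ η).compl
    rw [klDiv_of_not_ac (mt Measure.absolutelyContinuous_compProd_right_iff.1 hac), eq_comm,
      eq_top_iff]
    calc (∞ : ℝ≥0∞) = ∫⁻ _ in {x | ¬κ x ≪ η x}, ∞ ∂P := by
          rw [setLIntegral_const, ENNReal.top_mul (mt ae_iff.2 hac)]
      _ = ∫⁻ x in {x | ¬κ x ≪ η x}, klDiv (κ x) (η x) ∂P :=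
          setLIntegral_congr_fun hmeas fun x hx => (klDiv_of_not_ac hx).symm
      _ ≤ ∫⁻ x, klDiv (κ x) (η x) ∂P := setLIntegral_le_lintegral _ _

lemma klDiv_eq_tsum {Z : Type*} [MeasurableSpace Z] [Countable Z] [MeasurableSingletonClass Z]
    {μ ν : Measure Z} [IsFiniteMeasure μ] [IsFiniteMeasure ν] (hac : μ ≪ ν) :
    klDiv μ ν = ∑' z, ENNReal.ofReal (ν.real {z} * klFun (μ.real {z} / ν.real {z})) := by
  rw [klDiv_eq_lintegral_klFun_of_ac hac, lintegral_countable']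
  refine tsum_congr fun z => ?_
  have hatom : (μ.rnDeriv ν z).toReal * ν.real {z} = μ.real {z} := by
    rw [measureReal_def, measureReal_def, ← ENNReal.toReal_mul, ← lintegral_singleton,
      Measure.setLIntegral_rnDeriv hac]
  by_cases hz : ν.real {z} = 0
  · rw [hz, zero_mul, ENNReal.ofReal_zero, (measureReal_eq_zero_iff).1 hz, mul_zero]
  · rw [← eq_div_of_mul_eq hz hatom, ENNReal.ofReal_mul measureReal_nonneg, ofReal_measureReal,
      mul_comm]

lemma comp_measureReal {X Y : Type*} [MeasurableSpace X] [MeasurableSpace Y] (P : Measure X)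
    (M : Kernel X Y) [IsFiniteKernel M] {s : Set Y} (hs : MeasurableSet s) :
    (M ∘ₘ P).real s = ∫ x, (M x).real s ∂P := by
  rw [measureReal_def, Measure.bind_apply hs M.aemeasurable,
    ← integral_toReal (M.measurable_coe hs).aemeasurable (.of_forall fun x => measure_lt_top _ _)]
  rfl

lemma ae_absolutelyContinuous_comp {X Y : Type*} [MeasurableSpace X] [MeasurableSpace Y]
    [Countable Y] [MeasurableSingletonClass Y] (P : Measure X) (M : Kernel X Y) :
    ∀ᵐ x ∂P, M x ≪ M ∘ₘ P := by
  have hatom : ∀ᵐ x ∂P, ∀ y, (M ∘ₘ P) {y} = 0 → M x {y} = 0 := by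
    refine ae_all_iff.2 fun y => ?_
    by_cases hy : (M ∘ₘ P) {y} = 0
    · rw [Measure.bind_apply (measurableSet_singleton y) M.aemeasurable,
        lintegral_eq_zero_iff (M.measurable_coe (measurableSet_singleton y))] at hy
      filter_upwards [hy] with x hx _ using hx
    · exact .of_forall fun x h => absurd h hy
  filter_upwards [hatom] with x hx s hs
  rw [← Set.biUnion_of_singleton s, measure_biUnion_null_iff s.to_countable] at hs ⊢
  exact fun y hy => hx y (hs y hy)

lemma mutualInfo_eq_lintegral {X Y : Type*} [MeasurableSpace X] [MeasurableSpace Y]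
    [MeasurableSpace.CountableOrCountablyGenerated X Y] (P : Measure X) [IsFiniteMeasure P]
    (M : Kernel X Y) [IsFiniteKernel M] :
    mutualInfo P M = (∫⁻ x, klDiv (M x) (M ∘ₘ P) ∂P) / ENNReal.ofReal (Real.log 2) := by
  rw [mutualInfo, ← Measure.compProd_const, klDiv_compProd_eq_lintegral]
  rfl

end Divergence

section BinaryOutput

/-- The cross entropy, in nats, of the Bernoulli distribution with parameter `q` relative to the one
with parameter `p`. Writing a divergence as cross entropy minus entropy isolates its dependence on
`q`, and the cross entropy is affine in `p`. Since `Real.log 0 = 0`, it is only meaningful for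
`q = 0` if `p = 0`, and for `q = 1` if `p = 1`. -/
noncomputable def binCrossEntropy (p q : ℝ) : ℝ :=
  -p * Real.log q - (1 - p) * Real.log (1 - q)

lemma binCrossEntropy_self (p : ℝ) : binCrossEntropy p p = Real.binEntropy p := by
  rw [binCrossEntropy, Real.binEntropy_eq_negMulLog_add_negMulLog_one_sub, Real.negMulLog,
    Real.negMulLog]
  ring

lemma mul_klFun_div {p q : ℝ} (h : q = 0 → p = 0) :
    q * klFun (p / q) = p * Real.log p - p * Real.log q + q - p := by
  by_cases hq : q = 0
  · simp [hq, h hq]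
  by_cases hp : p = 0
  · simp [hp, klFun_apply]
  rw [klFun_apply, Real.log_div hp hq]
  field_simp

lemma binCrossEntropy_sub_binEntropy {p q : ℝ} (h0 : q = 0 → p = 0) (h1 : q = 1 → p = 1) :
    binCrossEntropy p q - Real.binEntropy p =
      q * klFun (p / q) + (1 - q) * klFun ((1 - p) / (1 - q)) := by
  have h1' : 1 - q = 0 → 1 - p = 0 := fun h => by rw [h1 (sub_eq_zero.1 h).symm, sub_self]
  rw [mul_klFun_div h0, mul_klFun_div h1', ← binCrossEntropy_self, binCrossEntropy,
    binCrossEntropy]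
  ring

lemma binEntropy_le_binCrossEntropy {p q : ℝ} (hp : p ∈ Set.Icc 0 1) (hq : q ∈ Set.Icc 0 1)
    (h0 : q = 0 → p = 0) (h1 : q = 1 → p = 1) : Real.binEntropy p ≤ binCrossEntropy p q := by
  have hp' := sub_nonneg.2 hp.2
  have hq' := sub_nonneg.2 hq.2
  rw [← sub_nonneg, binCrossEntropy_sub_binEntropy h0 h1]
  exact add_nonneg (mul_nonneg hq.1 (klFun_nonneg (div_nonneg hp.1 hq.1)))
    (mul_nonneg hq' (klFun_nonneg (div_nonneg hp' hq')))

lemma probReal_false (μ : Measure Bool) [IsProbabilityMeasure μ] :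
    μ.real {false} = 1 - μ.real {true} := by
  rw [← probReal_compl_eq_one_sub (measurableSet_singleton _), Bool.compl_singleton, Bool.not_true]

lemma measureReal_true_eq_zero_of_ac {μ ν : Measure Bool} [IsFiniteMeasure μ] [IsFiniteMeasure ν]
    (hac : μ ≪ ν) (h : ν.real {true} = 0) : μ.real {true} = 0 := by
  rw [measureReal_eq_zero_iff] at h ⊢
  exact hac h

lemma measureReal_true_eq_one_of_ac {μ ν : Measure Bool} [IsProbabilityMeasure μ]
    [IsProbabilityMeasure ν] (hac : μ ≪ ν) (h : ν.real {true} = 1) : μ.real {true} = 1 := by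
  have hfalse : μ.real {false} = 0 := by
    rw [measureReal_eq_zero_iff]
    refine hac ((measureReal_eq_zero_iff).1 ?_)
    rw [probReal_false, h, sub_self]
  rw [probReal_false] at hfalse
  linarith

lemma klDiv_bool {μ ν : Measure Bool} [IsProbabilityMeasure μ] [IsProbabilityMeasure ν]
    (hac : μ ≪ ν) :
    klDiv μ ν = ENNReal.ofReal
      (binCrossEntropy (μ.real {true}) (ν.real {true}) - Real.binEntropy (μ.real {true})) := by
  have hnonneg (b : Bool) : 0 ≤ ν.real {b} * klFun (μ.real {b} / ν.real {b}) :=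
    mul_nonneg measureReal_nonneg (klFun_nonneg (by positivity))
  rw [klDiv_eq_tsum hac, tsum_bool, add_comm, ← ENNReal.ofReal_add (hnonneg _) (hnonneg _),
    binCrossEntropy_sub_binEntropy (measureReal_true_eq_zero_of_ac hac)
      (measureReal_true_eq_one_of_ac hac), probReal_false, probReal_false]

lemma integrable_binEntropy {X : Type*} [MeasurableSpace X] {P : Measure X} [IsFiniteMeasure P]
    {f : X → ℝ} (hf : Measurable f) (h : ∀ x, f x ∈ Set.Icc 0 1) :
    Integrable (fun x => Real.binEntropy (f x)) P := by
  refine .of_bound (C := Real.log 2)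
    (Real.binEntropy_continuous.measurable.comp hf).aestronglyMeasurable (.of_forall fun x => ?_)
  rw [Real.norm_of_nonneg (Real.binEntropy_nonneg (h x).1 (h x).2)]
  exact Real.binEntropy_le_log_two

lemma integrable_binCrossEntropy {X : Type*} [MeasurableSpace X] {P : Measure X}
    [IsFiniteMeasure P] {f : X → ℝ} (hf : Integrable f P) (q : ℝ) :
    Integrable (fun x => binCrossEntropy (f x) q) P := by
  unfold binCrossEntropy
  fun_prop

lemma integral_binCrossEntropy {X : Type*} [MeasurableSpace X] {P : Measure X}
    [IsProbabilityMeasure P] {f : X → ℝ} (hf : Integrable f P) (q : ℝ) :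
    ∫ x, binCrossEntropy (f x) q ∂P = binCrossEntropy (∫ x, f x ∂P) q := by
  unfold binCrossEntropy
  rw [integral_sub (by fun_prop) (by fun_prop), integral_mul_const, integral_mul_const,
    integral_neg, integral_sub (integrable_const _) hf, integral_const, probReal_univ, one_smul]

lemma mutualInfo_bool {X : Type*} [MeasurableSpace X] (P : Measure X) [IsProbabilityMeasure P]
    (M : Kernel X Bool) [IsMarkovKernel M] :
    mutualInfo P M = ENNReal.ofReal (Real.binEntropy (∫ x, (M x).real {true} ∂P)
      - ∫ x, Real.binEntropy ((M x).real {true}) ∂P) / ENNReal.ofReal (Real.log 2) := by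
  have hmeas : Measurable fun x => (M x).real {true} :=
    (M.measurable_coe (measurableSet_singleton _)).ennreal_toReal
  have hmem (x : X) : (M x).real {true} ∈ Set.Icc (0 : ℝ) 1 :=
    ⟨measureReal_nonneg, measureReal_le_one⟩
  have hint : Integrable (fun x => (M x).real {true}) P :=
    .of_mem_Icc 0 1 hmeas.aemeasurable (.of_forall hmem)
  have hintH := integrable_binEntropy (P := P) hmeas hmem
  have hac := ae_absolutelyContinuous_comp P M
  rw [mutualInfo_eq_lintegral, ← comp_measureReal P M (measurableSet_singleton _)]
  set q := (M ∘ₘ P).real {true}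
  have hintCross := integrable_binCrossEntropy hint q
  have hgibbs : ∀ᵐ x ∂P, 0 ≤
      binCrossEntropy ((M x).real {true}) q - Real.binEntropy ((M x).real {true}) := by
    filter_upwards [hac] with x hx
    exact sub_nonneg.2 (binEntropy_le_binCrossEntropy (hmem x)
      ⟨measureReal_nonneg, measureReal_le_one⟩ (measureReal_true_eq_zero_of_ac hx)
      (measureReal_true_eq_one_of_ac hx))
  congr 1
  calc ∫⁻ x, klDiv (M x) (M ∘ₘ P) ∂P
    _ = ∫⁻ x, ENNReal.ofReal
          (binCrossEntropy ((M x).real {true}) q - Real.binEntropy ((M x).real {true})) ∂P :=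
        lintegral_congr_ae (hac.mono fun x hx => klDiv_bool hx)
    _ = ENNReal.ofReal (∫ x, binCrossEntropy ((M x).real {true}) q
          - Real.binEntropy ((M x).real {true}) ∂P) :=
        (ofReal_integral_eq_lintegral_ofReal (hintCross.sub hintH) hgibbs).symm
    _ = _ := by
        rw [integral_sub hintCross hintH, integral_binCrossEntropy hint,
          ← comp_measureReal P M (measurableSet_singleton _), binCrossEntropy_self]

/-- The mutual information, in nats, between a binary input that is `1` with probability `t` and
the output of the channel that outputs `1` with probability `p₀` on input `0` and with probability
`p₁` on input `1`. -/
noncomputable def binaryInfo (t p₀ p₁ : ℝ) : ℝ :=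
  Real.binEntropy (t * p₁ + (1 - t) * p₀) - t * Real.binEntropy p₁ - (1 - t) * Real.binEntropy p₀

variable {X : Type*} [MeasurableSpace X]

lemma integral_bernoulliMeasure_of_measurable (x y : X) (t : I) {f : X → ℝ} (hf : Measurable f) :
    ∫ z, f z ∂bernoulliMeasure x y t = t * f x + (1 - t) * f y := by
  have hint (z : X) : Integrable f (Measure.dirac z) :=
    integrable_dirac' hf.stronglyMeasurable (by simp)
  rw [bernoulliMeasure_def, integral_add_measure (hint x).smul_measure_nnreal
    (hint y).smul_measure_nnreal, integral_smul_nnreal_measure, integral_smul_nnreal_measure,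
    integral_dirac' _ _ hf.stronglyMeasurable, integral_dirac' _ _ hf.stronglyMeasurable]
  rfl

lemma mutualInfo_bernoulliMeasure (x x' : X) (t : I) (M : Kernel X Bool) [IsMarkovKernel M] :
    mutualInfo (bernoulliMeasure x x' t) M =
      ENNReal.ofReal (binaryInfo t ((M x').real {true}) ((M x).real {true}))
        / ENNReal.ofReal (Real.log 2) := by
  have hmeas : Measurable fun z => (M z).real {true} :=
    (M.measurable_coe (measurableSet_singleton _)).ennreal_toReal
  have hmeasH : Measurable fun z => Real.binEntropy ((M z).real {true}) :=
    Real.binEntropy_continuous.measurable.comp hmeas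
  rw [mutualInfo_bool, integral_bernoulliMeasure_of_measurable _ _ _ hmeas,
    integral_bernoulliMeasure_of_measurable _ _ _ hmeasH, binaryInfo, sub_sub]

instance (p : I) : IsProbabilityMeasure (ber p) := by
  unfold ber; infer_instance

open scoped Classical in
lemma ber_real (p : I) (s : Set Bool) :
    (ber p).real s = (if true ∈ s then (p : ℝ) else 0) + if false ∈ s then 1 - (p : ℝ) else 0 := by
  rw [ber, bernoulliMeasure_real_apply _ .of_discrete]
  split_ifs <;> simp

variable {A : Set X} (hA : MeasurableSet A) (p₀ p₁ : I)

instance : IsMarkovKernel (berMechanism hA p₀ p₁) := by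
  unfold berMechanism; infer_instance

lemma berMechanism_apply_of_mem {x : X} (hx : x ∈ A) : berMechanism hA p₀ p₁ x = ber p₁ := by
  simp [berMechanism, Kernel.piecewise_apply, hx]

lemma berMechanism_apply_of_notMem {x : X} (hx : x ∉ A) : berMechanism hA p₀ p₁ x = ber p₀ := by
  simp [berMechanism, Kernel.piecewise_apply, hx]

open scoped Classical in
lemma berMechanism_real_true (x : X) :
    (berMechanism hA p₀ p₁ x).real {true} = if x ∈ A then (p₁ : ℝ) else p₀ := by
  split_ifs with hx
  · simp [berMechanism_apply_of_mem hA p₀ p₁ hx, ber_real]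
  · simp [berMechanism_apply_of_notMem hA p₀ p₁ hx, ber_real]

open scoped Classical in
lemma integral_ite_const (P : Measure X) [IsProbabilityMeasure P] {A : Set X}
    (hA : MeasurableSet A) (a b : ℝ) :
    ∫ x, (if x ∈ A then a else b) ∂P = P.real A * a + (1 - P.real A) * b := by
  change ∫ x, A.piecewise (fun _ => a) (fun _ => b) x ∂P = _
  rw [integral_piecewise hA integrableOn_const integrableOn_const, setIntegral_const,
    setIntegral_const, probReal_compl_eq_one_sub hA, smul_eq_mul, smul_eq_mul]

lemma mutualInfo_berMechanism (P : Measure X) [IsProbabilityMeasure P] :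
    mutualInfo P (berMechanism hA p₀ p₁) =
      ENNReal.ofReal (binaryInfo (P.real A) p₀ p₁) / ENNReal.ofReal (Real.log 2) := by
  classical
  simp only [mutualInfo_bool, berMechanism_real_true, apply_ite Real.binEntropy,
    integral_ite_const P hA, binaryInfo, sub_sub]

end BinaryOutput

section Capacity

lemma bac_eq_berMechanism (a b : I) :
    bac a b = berMechanism (MeasurableSet.of_discrete (s := {true})) a (σ b) := by
  ext1 x
  cases x
  · rw [berMechanism_apply_of_notMem _ _ _ (by simp)]
    rfl
  · rw [berMechanism_apply_of_mem _ _ _ (by simp)]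
    rfl

lemma bacCapacity_eq_iSup (a b : I) :
    bacCapacity a b = ⨆ t : I, ENNReal.ofReal (binaryInfo t a (1 - b))
      / ENNReal.ofReal (Real.log 2) := by
  simp only [bacCapacity, bac_eq_berMechanism, mutualInfo_berMechanism, coe_symm_eq]
  apply le_antisymm
  · exact iSup_le fun P => le_iSup (fun t : I => ENNReal.ofReal (binaryInfo t a (1 - b))
      / ENNReal.ofReal (Real.log 2)) ⟨_, measureReal_nonneg, measureReal_le_one⟩
  · refine iSup_le fun t => le_iSup_of_le ⟨ber t, inferInstance⟩ (le_of_eq ?_)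
    simp [ber_real]

lemma ofReal_binaryInfo_le_bacCapacity (t p₀ p₁ : I) :
    ENNReal.ofReal (binaryInfo t p₀ p₁) / ENNReal.ofReal (Real.log 2) ≤
      bacCapacity p₀ (σ p₁) := by
  rw [bacCapacity_eq_iSup, coe_symm_eq, sub_sub_cancel]
  exact le_iSup (fun t : I => ENNReal.ofReal (binaryInfo t p₀ p₁) / ENNReal.ofReal (Real.log 2)) t

lemma mutualInfo_berMechanism_le {X : Type*} [MeasurableSpace X] {A : Set X} (P : Measure X)
    [IsProbabilityMeasure P] (hA : MeasurableSet A) (p₀ p₁ : I) :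
    mutualInfo P (berMechanism hA p₀ p₁) ≤ bacCapacity p₀ (σ p₁) := by
  rw [mutualInfo_berMechanism]
  exact ofReal_binaryInfo_le_bacCapacity ⟨_, measureReal_nonneg, measureReal_le_one⟩ p₀ p₁

lemma binaryInfo_one_sub_left (t p₀ p₁ : ℝ) : binaryInfo (1 - t) p₀ p₁ = binaryInfo t p₁ p₀ := by
  rw [binaryInfo, binaryInfo, sub_sub_cancel, add_comm]
  ring

lemma binaryInfo_one_sub_one_sub (t p₀ p₁ : ℝ) :
    binaryInfo t (1 - p₀) (1 - p₁) = binaryInfo t p₀ p₁ := by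
  have hmix : t * (1 - p₁) + (1 - t) * (1 - p₀) = 1 - (t * p₁ + (1 - t) * p₀) := by ring
  simp only [binaryInfo, hmix, Real.binEntropy_one_sub]

lemma binaryInfo_self (t p : ℝ) : binaryInfo t p p = 0 := by
  rw [binaryInfo, ← add_mul, add_sub_cancel, one_mul]
  ring

lemma bacCapacity_symm_symm (a b : I) : bacCapacity (σ a) (σ b) = bacCapacity a b := by
  simp only [bacCapacity_eq_iSup, coe_symm_eq, binaryInfo_one_sub_one_sub]

lemma bacCapacity_swap (a b : I) : bacCapacity a b = bacCapacity b a := by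
  simp only [bacCapacity_eq_iSup]
  refine Equiv.iSup_congr symmHomeomorph.toEquiv fun t => ?_
  have ht : ((symmHomeomorph.toEquiv t : I) : ℝ) = 1 - t := rfl
  rw [ht, binaryInfo_one_sub_left, ← binaryInfo_one_sub_one_sub, sub_sub_cancel]

lemma bacCapacity_eq_zero {a b : I} (h : (a : ℝ) + b = 1) : bacCapacity a b = 0 := by
  simp [bacCapacity_eq_iSup, ← eq_sub_of_add_eq h, binaryInfo_self]

lemma lowerSemicontinuous_bacCapacity :
    LowerSemicontinuous fun p : I × I => bacCapacity p.1 (σ p.2) := by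
  simp only [bacCapacity_eq_iSup, coe_symm_eq, sub_sub_cancel]
  refine lowerSemicontinuous_iSup fun t => Continuous.lowerSemicontinuous ?_
  refine (ENNReal.continuous_div_const _ (by simp [Real.log_pos])).comp
    (ENNReal.continuous_ofReal.comp ?_)
  unfold binaryInfo
  fun_prop

end Capacity

section ClosedForm

lemma binEntropyBits_eq (p : ℝ) : binEntropyBits p = Real.binEntropy p / Real.log 2 := by
  rw [binEntropyBits, Real.binEntropy_eq_negMulLog_add_negMulLog_one_sub, Real.negMulLog,
    Real.negMulLog, Real.logb, Real.logb]
  ring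

lemma sigmoid_eq_exp_div (c : ℝ) : Real.sigmoid c = Real.exp c / (1 + Real.exp c) := by
  rw [Real.sigmoid_def, Real.exp_neg]
  field_simp
  ring

lemma log_sigmoid (c : ℝ) : Real.log (Real.sigmoid c) = c - Real.log (1 + Real.exp c) := by
  rw [sigmoid_eq_exp_div, Real.log_div (by positivity) (by positivity), Real.log_exp]

lemma log_one_sub_sigmoid (c : ℝ) :
    Real.log (1 - Real.sigmoid c) = -Real.log (1 + Real.exp c) := by
  rw [← Real.sigmoid_neg, Real.sigmoid_def, neg_neg, Real.log_inv]

lemma binCrossEntropy_sigmoid (p c : ℝ) :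
    binCrossEntropy p (Real.sigmoid c) = Real.log (1 + Real.exp c) - p * c := by
  rw [binCrossEntropy, log_sigmoid, log_one_sub_sigmoid]
  ring

-- The cross entropy of `sigmoid c` relative to `p` is affine in `p` with slope `-c`, and it is the
-- tangent line to the entropy at `sigmoid c`, which lies above the entropy by the Gibbs inequality.
lemma binEntropy_add_mul_le {p : ℝ} (hp : p ∈ Set.Icc (0 : ℝ) 1) (c : ℝ) :
    Real.binEntropy p + p * c ≤ Real.log (1 + Real.exp c) := by
  have h := binEntropy_le_binCrossEntropy hp ⟨Real.sigmoid_nonneg c, Real.sigmoid_le_one c⟩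
    (fun h => absurd h (Real.sigmoid_pos c).ne') (fun h => absurd h (Real.sigmoid_lt_one c).ne)
  rw [binCrossEntropy_sigmoid] at h
  linarith

lemma binEntropy_sigmoid_add_mul (c : ℝ) :
    Real.binEntropy (Real.sigmoid c) + Real.sigmoid c * c = Real.log (1 + Real.exp c) := by
  rw [← binCrossEntropy_self, binCrossEntropy_sigmoid, sub_add_cancel]

/-- The slope of the linear functional that is added to the entropy of the output distribution when
the mutual information over a binary asymmetric channel is written as a function of that
distribution (`binaryInfo_eq`). The optimal output distribution is Bernoulli with parameter
`Real.sigmoid (bacSlope a b)`. -/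
noncomputable def bacSlope (a b : ℝ) : ℝ :=
  (Real.binEntropy a - Real.binEntropy b) / (1 - a - b)

/-- The closed form for the capacity of the binary asymmetric channel, in nats; meant for
`a + b ≠ 1`. -/
noncomputable def bacNats (a b : ℝ) : ℝ :=
  a / (1 - a - b) * Real.binEntropy b - (1 - b) / (1 - a - b) * Real.binEntropy a
    + Real.log (1 + Real.exp (bacSlope a b))

lemma bacFormula_eq (a b : ℝ) : bacFormula a b = bacNats a b / Real.log 2 := by
  have hl : Real.log 2 ≠ 0 := (Real.log_pos one_lt_two).ne'
  have hexp : Real.log 2 * ((Real.binEntropy a / Real.log 2 - Real.binEntropy b / Real.log 2) /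
      (1 - a - b)) = bacSlope a b := by
    rw [bacSlope]
    field_simp
  rw [bacFormula, bacNats, binEntropyBits_eq, binEntropyBits_eq, Real.logb,
    Real.rpow_def_of_pos two_pos, hexp]
  ring

lemma binaryInfo_eq {a b t : ℝ} (hab : 1 - a - b ≠ 0) :
    binaryInfo t a (1 - b) = a / (1 - a - b) * Real.binEntropy b
      - (1 - b) / (1 - a - b) * Real.binEntropy a
      + (Real.binEntropy (a + t * (1 - a - b)) + (a + t * (1 - a - b)) * bacSlope a b) := by
  have hmix : t * (1 - b) + (1 - t) * a = a + t * (1 - a - b) := by ring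
  rw [binaryInfo, bacSlope, Real.binEntropy_one_sub, hmix]
  generalize Real.binEntropy (a + t * (1 - a - b)) = H
  field_simp
  ring

lemma binaryInfo_le_bacNats {a b t : ℝ} (ha : 0 ≤ a) (hb : 0 ≤ b) (hab : a + b < 1)
    (ht : t ∈ Set.Icc (0 : ℝ) 1) : binaryInfo t a (1 - b) ≤ bacNats a b := by
  have hpos : 0 < 1 - a - b := by linarith
  have h0 := mul_nonneg ht.1 hpos.le
  have h1 := mul_nonneg (sub_nonneg.2 ht.2) hpos.le
  rw [binaryInfo_eq hpos.ne', bacNats]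
  gcongr
  exact binEntropy_add_mul_le ⟨by linarith, by linarith⟩ _

lemma bacNats_nonneg {a b : ℝ} (ha : 0 ≤ a) (hb : 0 ≤ b) (hab : a + b < 1) : 0 ≤ bacNats a b := by
  have h := binaryInfo_le_bacNats ha hb hab (t := 0) ⟨le_rfl, zero_le_one⟩
  simpa [binaryInfo] using h

-- As `a` is the probability of output `1` on input `0`, this and `sigmoid_bacSlope_le` say that the
-- optimal output distribution is attained by an input distribution.
lemma le_sigmoid_bacSlope {a b : ℝ} (ha : 0 ≤ a) (hb : 0 ≤ b) (hab : a + b < 1) :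
    a ≤ Real.sigmoid (bacSlope a b) := by
  rcases ha.eq_or_lt with rfl | ha
  · exact Real.sigmoid_nonneg _
  have hlogit : Real.log a - Real.log (1 - a) ≤ bacSlope a b := by
    have hgibbs : Real.binEntropy (1 - b) ≤ binCrossEntropy (1 - b) a :=
      binEntropy_le_binCrossEntropy ⟨by linarith, by linarith⟩ ⟨ha.le, by linarith⟩
        (fun h => absurd h ha.ne') (fun h => by linarith)
    rw [Real.binEntropy_one_sub, binCrossEntropy] at hgibbs
    rw [bacSlope, le_div_iff₀ (by linarith), ← binCrossEntropy_self, binCrossEntropy]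
    linarith
  have ha1 : 0 < 1 - a := by linarith
  rw [← Real.log_div ha.ne' ha1.ne', Real.log_le_iff_le_exp (div_pos ha ha1),
    div_le_iff₀ ha1] at hlogit
  rw [sigmoid_eq_exp_div, le_div_iff₀ (by positivity)]
  linarith

lemma bacSlope_swap (a b : ℝ) : bacSlope b a = -bacSlope a b := by
  rw [bacSlope, bacSlope, ← neg_div, neg_sub, sub_right_comm]

lemma sigmoid_bacSlope_le {a b : ℝ} (ha : 0 ≤ a) (hb : 0 ≤ b) (hab : a + b < 1) :
    Real.sigmoid (bacSlope a b) ≤ 1 - b := by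
  have h := le_sigmoid_bacSlope hb ha (by rwa [add_comm])
  rw [bacSlope_swap, Real.sigmoid_neg] at h
  linarith

lemma exists_binaryInfo_eq_bacNats {a b : ℝ} (ha : 0 ≤ a) (hb : 0 ≤ b) (hab : a + b < 1) :
    ∃ t ∈ Set.Icc (0 : ℝ) 1, binaryInfo t a (1 - b) = bacNats a b := by
  have hpos : 0 < 1 - a - b := by linarith
  have hle := le_sigmoid_bacSlope ha hb hab
  have hge := sigmoid_bacSlope_le ha hb hab
  refine ⟨(Real.sigmoid (bacSlope a b) - a) / (1 - a - b),
    ⟨div_nonneg (by linarith) hpos.le, (div_le_one hpos).2 (by linarith)⟩, ?_⟩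
  rw [binaryInfo_eq hpos.ne', div_mul_cancel₀ _ hpos.ne', add_sub_cancel,
    binEntropy_sigmoid_add_mul, bacNats]

lemma bacCapacity_eq_bacNats {a b : I} (hab : (a : ℝ) + b < 1) :
    bacCapacity a b = ENNReal.ofReal (bacNats a b) / ENNReal.ofReal (Real.log 2) := by
  rw [bacCapacity_eq_iSup]
  apply le_antisymm
  · refine iSup_le fun t => ?_
    gcongr
    exact binaryInfo_le_bacNats a.2.1 b.2.1 hab t.2
  · obtain ⟨t, ht, heq⟩ := exists_binaryInfo_eq_bacNats a.2.1 b.2.1 hab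
    rw [← heq]
    exact le_iSup (fun t : I => ENNReal.ofReal (binaryInfo t a (1 - b))
      / ENNReal.ofReal (Real.log 2)) ⟨t, ht⟩

lemma bacCapacity_eq_bacFormula {a b : I} (hab : (a : ℝ) + b < 1) :
    bacCapacity a b = ENNReal.ofReal (bacFormula a b) := by
  rw [bacCapacity_eq_bacNats hab, ← ENNReal.ofReal_div_of_pos (Real.log_pos one_lt_two),
    bacFormula_eq]

lemma bacFormula_nonneg {a b : ℝ} (ha : 0 ≤ a) (hb : 0 ≤ b) (hab : a + b < 1) :
    0 ≤ bacFormula a b := by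
  rw [bacFormula_eq]
  exact div_nonneg (bacNats_nonneg ha hb hab) (Real.log_pos one_lt_two).le

end ClosedForm

section Extremal

lemma isGreatest_deltaLDP (μ : ℝ≥0∞) (ε : ℝ) : IsGreatest (ldpValues μ ε) (deltaLDP μ ε) := by
  set K := {p : I × I | bacCapacity p.1 (σ p.2) ≤ μ}
  have hK : IsCompact K := (lowerSemicontinuous_bacCapacity.isClosed_preimage μ).isCompact
  have hne : K.Nonempty := ⟨(0, 0), (bacCapacity_eq_zero (by simp)).trans_le zero_le⟩
  have hcont : Continuous fun p : I × I => ldpObjective ε p.1 p.2 := by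
    unfold ldpObjective
    fun_prop
  have himage : ldpValues μ ε = (fun p : I × I => ldpObjective ε p.1 p.2) '' K := by
    ext d
    simp only [ldpValues, K, Set.mem_ofPred_eq, Set.mem_image, Prod.exists, eq_comm]
  rw [deltaLDP, himage]
  exact (hK.image hcont).isGreatest_sSup (hne.image _)

lemma ldpObjective_le_deltaLDP {μ : ℝ≥0∞} {p₀ p₁ : I} (h : bacCapacity p₀ (σ p₁) ≤ μ) (ε : ℝ) :
    ldpObjective ε p₀ p₁ ≤ deltaLDP μ ε :=
  (isGreatest_deltaLDP μ ε).2 ⟨p₀, p₁, h, rfl⟩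

lemma forall_ber_real_le_iff {ε δ : ℝ} (hε : 0 ≤ ε) (p q : I) :
    (∀ s, (ber p).real s ≤ Real.exp ε * (ber q).real s + δ) ↔
      0 ≤ δ ∧ p - Real.exp ε * q ≤ δ ∧ (1 - p) - Real.exp ε * (1 - q) ≤ δ := by
  have hexp := Real.one_le_exp hε
  classical
  simp only [ber_real]
  constructor
  · intro h
    have hempty := h ∅
    have htrue := h {true}
    have hfalse := h {false}
    simp only [Set.mem_empty_iff_false, Set.mem_singleton_iff, Bool.false_eq_true,
      Bool.true_eq_false, if_true, if_false, add_zero, zero_add, mul_zero] at hempty htrue hfalse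
    exact ⟨hempty, by linarith, by linarith⟩
  · rintro ⟨h0, htrue, hfalse⟩ s
    split_ifs <;> linarith

variable {X : Type*} [MeasurableSpace X] {A : Set X}

lemma isLDP_berMechanism_iff (hA : MeasurableSet A) (hA1 : A.Nonempty) (hA0 : Aᶜ.Nonempty)
    {ε δ : ℝ} (hε : 0 ≤ ε) (p₀ p₁ : I) :
    IsLDP ε δ (berMechanism hA p₀ p₁) ↔
      max (ldpObjective ε p₀ p₁) (ldpObjective ε (σ p₀) (σ p₁)) ≤ δ := by
  simp only [ldpObjective, max_le_iff, coe_symm_eq]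
  constructor
  · intro h
    obtain ⟨x, hx⟩ := hA1
    obtain ⟨y, hy⟩ := hA0
    have h10 := (forall_ber_real_le_iff hε p₁ p₀).1 fun s => by
      simpa only [berMechanism_apply_of_mem hA p₀ p₁ hx, berMechanism_apply_of_notMem hA p₀ p₁ hy]
        using h x y s .of_discrete
    have h01 := (forall_ber_real_le_iff hε p₀ p₁).1 fun s => by
      simpa only [berMechanism_apply_of_mem hA p₀ p₁ hx, berMechanism_apply_of_notMem hA p₀ p₁ hy]
        using h y x s .of_discrete
    exact ⟨⟨h10.1, h01.2.1, h10.2.1⟩, h10.1, h01.2.2, h10.2.2⟩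
  · rintro ⟨⟨h0, h01, h10⟩, -, h01', h10'⟩ x y s -
    have hself (p : I) : (ber p).real s ≤ Real.exp ε * (ber p).real s + δ :=
      (le_mul_of_one_le_left measureReal_nonneg (Real.one_le_exp hε)).trans
        (le_add_of_nonneg_right h0)
    by_cases hx : x ∈ A <;> by_cases hy : y ∈ A <;>
      simp only [hx, hy, not_false_eq_true, berMechanism_apply_of_mem,
        berMechanism_apply_of_notMem]
    exacts [hself _, (forall_ber_real_le_iff hε _ _).2 ⟨h0, h10, h10'⟩ s,
      (forall_ber_real_le_iff hε _ _).2 ⟨h0, h01, h01'⟩ s, hself _]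

-- Exchanging the two outputs preserves the capacity, so `(σ p₀, σ p₁)` is a feasible pair as well.
lemma max_ldpObjective_symm_eq_deltaLDP {μ : ℝ≥0∞} {ε : ℝ} {p₀ p₁ : I}
    (hp : bacCapacity p₀ (σ p₁) ≤ μ) (hmax : ldpObjective ε p₀ p₁ = deltaLDP μ ε) :
    max (ldpObjective ε p₀ p₁) (ldpObjective ε (σ p₀) (σ p₁)) = deltaLDP μ ε := by
  rw [hmax]
  exact max_eq_left (ldpObjective_le_deltaLDP (by rwa [bacCapacity_symm_symm]) ε)

end Extremal

section Conversion

variable {X Y Z : Type*} [MeasurableSpace X] [MeasurableSpace Y] [MeasurableSpace Z]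

lemma mutualInfo_map_le (P : Measure X) [IsFiniteMeasure P] (M : Kernel X Y)
    [IsFiniteKernel M] {g : Y → Z} (hg : Measurable g) :
    mutualInfo P (M.map g) ≤ mutualInfo P M := by
  have hprod : P.prod ((M ∘ₘ P).map g) = (P.prod (M ∘ₘ P)).map (Prod.map id g) := by
    rw [← Measure.map_prod_map _ _ measurable_id hg, Measure.map_id]
  rw [mutualInfo, mutualInfo, Measure.compProd_map hg, ← Measure.map_comp _ _ hg, hprod]
  gcongr
  exact klDiv_map_le _ _ (measurable_id.prodMap hg)

lemma mutualInfo_le_of_isCILMIP {𝓓 : Set (ProbabilityMeasure X)} {μ : ℝ≥0∞} {M : Kernel X Y}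
    (hM : IsCILMIP 𝓓 μ M) {P : ProbabilityMeasure X} (hP : P ∈ 𝓓) :
    mutualInfo (P : Measure X) M ≤ μ :=
  (le_iSup₂ (f := fun (Q : ProbabilityMeasure X) (_ : Q ∈ 𝓓) => mutualInfo (Q : Measure X) M)
    P hP).trans hM

lemma bacCapacity_le_of_isCILMIP {𝓓 : Set (ProbabilityMeasure X)} (h𝓓 : ContainsTwoPoint 𝓓)
    {μ : ℝ≥0∞} {M : Kernel X Y} [IsMarkovKernel M] (hM : IsCILMIP 𝓓 μ M) {E : Set Y}
    (hE : MeasurableSet E) {x x' : X} {p p' : I} (hp : (M x).real E = p)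
    (hp' : (M x').real E = p') : bacCapacity p' (σ p) ≤ μ := by
  classical
  have hdecide : Measurable fun y => decide (y ∈ E) :=
    measurable_to_bool (by simpa [Set.preimage] using hE)
  have hevent (z : X) : (M.map (fun y => decide (y ∈ E)) z).real {true} = (M z).real E := by
    rw [measureReal_def, Kernel.map_apply' _ hdecide _ (.of_discrete)]
    simp [Set.preimage, measureReal_def]
  rw [bacCapacity_eq_iSup]
  refine iSup_le fun t => ?_
  let P : ProbabilityMeasure X := ⟨bernoulliMeasure x x' t, inferInstance⟩
  have := Kernel.IsMarkovKernel.map M hdecide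
  calc ENNReal.ofReal (binaryInfo t p' (1 - (1 - p))) / ENNReal.ofReal (Real.log 2)
    _ = mutualInfo (bernoulliMeasure x x' t) (M.map fun y => decide (y ∈ E)) := by
      rw [mutualInfo_bernoulliMeasure, hevent, hevent, hp, hp', sub_sub_cancel]
    _ ≤ mutualInfo (bernoulliMeasure x x' t) M := mutualInfo_map_le _ M hdecide
    _ ≤ μ := mutualInfo_le_of_isCILMIP hM (h𝓓 x x' t P rfl)

lemma isLDP_of_isCILMIP {𝓓 : Set (ProbabilityMeasure X)} (h𝓓 : ContainsTwoPoint 𝓓) {μ : ℝ≥0∞}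
    {M : Kernel X Y} [IsMarkovKernel M] (hM : IsCILMIP 𝓓 μ M) (ε : ℝ) :
    IsLDP ε (deltaLDP μ ε) M := by
  intro x x' E hE
  let p (z : X) : I := ⟨(M z).real E, measureReal_nonneg, measureReal_le_one⟩
  have hobj : ldpObjective ε (p x') (p x) ≤ deltaLDP μ ε :=
    ldpObjective_le_deltaLDP (bacCapacity_le_of_isCILMIP h𝓓 hM hE rfl rfl) ε
  have hdiff : (M x).real E - Real.exp ε * (M x').real E ≤ deltaLDP μ ε :=
    ((le_max_right _ _).trans (le_max_right _ _)).trans hobj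
  linarith

end Conversion

section HockeyStick

lemma ofReal_intervalIntegral_le_setLIntegral {f : ℝ → ℝ} (hf : Continuous f) {a b : ℝ}
    (hab : a ≤ b) (h : ∀ x ∈ Set.Ioc a b, 0 ≤ f x) :
    ENNReal.ofReal (∫ x in a..b, f x) ≤ ∫⁻ x in Set.Ioi a, ENNReal.ofReal (f x) := by
  rw [intervalIntegral.integral_of_le hab, ofReal_integral_eq_lintegral_ofReal
    hf.integrableOn_Ioc ((ae_restrict_iff' measurableSet_Ioc).2 (.of_forall h))]
  exact lintegral_mono_set Set.Ioc_subset_Ioi_self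

lemma ofReal_klFun_le_of_one_le {r : ℝ} (hr : 1 ≤ r) :
    ENNReal.ofReal (klFun r) ≤ ∫⁻ ε in Set.Ioi (0 : ℝ), ENNReal.ofReal (r - Real.exp ε) := by
  have hpos : 0 < r := one_pos.trans_le hr
  have hint : ∫ ε in (0 : ℝ)..Real.log r, (r - Real.exp ε) = klFun r := by
    rw [intervalIntegral.integral_sub (by simp) (by simp), integral_exp, Real.exp_log hpos,
      intervalIntegral.integral_const, klFun_apply, Real.exp_zero, smul_eq_mul]
    ring
  rw [← hint]
  refine ofReal_intervalIntegral_le_setLIntegral (by fun_prop) (Real.log_nonneg hr) fun ε hε => ?_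
  exact sub_nonneg.2 ((Real.le_log_iff_exp_le hpos).1 hε.2)

lemma ofReal_klFun_le_of_le_one {r : ℝ} (hr0 : 0 ≤ r) (hr1 : r ≤ 1) :
    ENNReal.ofReal (klFun r) ≤ ∫⁻ ε in Set.Ioi (0 : ℝ), ENNReal.ofReal (Real.exp (-ε) - r) := by
  rcases hr0.eq_or_lt with rfl | hpos
  · have hexp : IntegrableOn (fun ε : ℝ => Real.exp (-ε)) (Set.Ioi 0) := by
      simpa using exp_neg_integrableOn_Ioi 0 one_pos
    simp only [sub_zero]
    rw [klFun_zero, ← integral_exp_neg_Ioi_zero,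
      ofReal_integral_eq_lintegral_ofReal hexp (.of_forall fun ε => (Real.exp_pos _).le)]
  · have hint : ∫ ε in (0 : ℝ)..(-Real.log r), (Real.exp (-ε) - r) = klFun r := by
      rw [intervalIntegral.integral_sub (Continuous.intervalIntegrable (by fun_prop) _ _)
        (by simp), intervalIntegral.integral_comp_neg (fun x => Real.exp x), integral_exp,
        neg_neg, neg_zero, Real.exp_log hpos, intervalIntegral.integral_const, klFun_apply,
        Real.exp_zero, smul_eq_mul]
      ring
    rw [← hint]
    refine ofReal_intervalIntegral_le_setLIntegral (by fun_prop)
      (neg_nonneg.2 (Real.log_nonpos hr0 hr1)) fun ε hε => ?_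
    exact sub_nonneg.2 ((Real.log_le_iff_le_exp hpos).1 (le_neg_of_le_neg hε.2))

/-- The integrand `(r - e^ε)⁺ + e^{-ε} (1 - e^ε r)⁺` at the likelihood ratio `r` that represents the
Kullback-Leibler divergence as an integral of hockey-stick divergences. Truncated subtraction in
`ℝ≥0∞` supplies the positive parts. -/
noncomputable def hockeyStickIntegrand (r : ℝ≥0∞) (ε : ℝ) : ℝ≥0∞ :=
  (r - ENNReal.ofReal (Real.exp ε))
    + ENNReal.ofReal (Real.exp (-ε)) * (1 - ENNReal.ofReal (Real.exp ε) * r)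

lemma hockeyStickIntegrand_ofReal {r : ℝ} (hr : 0 ≤ r) (ε : ℝ) :
    hockeyStickIntegrand (ENNReal.ofReal r) ε =
      ENNReal.ofReal (r - Real.exp ε) + ENNReal.ofReal (Real.exp (-ε) - r) := by
  have hcancel : Real.exp (-ε) * (1 - Real.exp ε * r) = Real.exp (-ε) - r := by
    rw [mul_sub, ← mul_assoc, ← Real.exp_add, neg_add_cancel, Real.exp_zero, mul_one, one_mul]
  rw [hockeyStickIntegrand, ← hcancel, ENNReal.ofReal_mul (Real.exp_pos _).le,
    ENNReal.ofReal_sub _ (Real.exp_pos ε).le, ENNReal.ofReal_sub _ (by positivity),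
    ENNReal.ofReal_mul (Real.exp_pos ε).le, ENNReal.ofReal_one]

lemma ofReal_klFun_toReal_le {r : ℝ≥0∞} (hr : r ≠ ∞) :
    ENNReal.ofReal (klFun r.toReal) ≤ ∫⁻ ε in Set.Ioi (0 : ℝ), hockeyStickIntegrand r ε := by
  obtain ⟨r, hr0, rfl⟩ : ∃ x : ℝ, 0 ≤ x ∧ ENNReal.ofReal x = r :=
    ⟨r.toReal, ENNReal.toReal_nonneg, ENNReal.ofReal_toReal hr⟩
  simp only [ENNReal.toReal_ofReal hr0, hockeyStickIntegrand_ofReal hr0]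
  rcases le_total 1 r with h1 | h1
  · exact (ofReal_klFun_le_of_one_le h1).trans (lintegral_mono fun ε => le_self_add)
  · exact (ofReal_klFun_le_of_le_one hr0 h1).trans (lintegral_mono fun ε => le_add_self)

variable {Z : Type*} [MeasurableSpace Z]

lemma lintegral_tsub_le {ν : Measure Z} {f g : Z → ℝ≥0∞} (hf : Measurable f) (hg : Measurable g)
    (hg' : ∫⁻ z, g z ∂ν ≠ ∞) {d : ℝ≥0∞}
    (h : ∀ s, MeasurableSet s → ∫⁻ z in s, f z ∂ν ≤ ∫⁻ z in s, g z ∂ν + d) :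
    ∫⁻ z, f z - g z ∂ν ≤ d := by
  have hs : MeasurableSet {z | g z < f z} := measurableSet_lt hg hf
  calc ∫⁻ z, f z - g z ∂ν
    _ = ∫⁻ z in {z | g z < f z}, f z - g z ∂ν := by
        refine (setLIntegral_eq_of_support_subset fun z hz => ?_).symm
        exact tsub_pos_iff_lt.1 (pos_iff_ne_zero.2 hz)
    _ = ∫⁻ z in {z | g z < f z}, f z ∂ν - ∫⁻ z in {z | g z < f z}, g z ∂ν :=
        lintegral_sub hg (ne_top_of_le_ne_top hg' (setLIntegral_le_lintegral _ _))
          ((ae_restrict_iff' hs).2 (.of_forall fun _ hz => le_of_lt hz))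
    _ ≤ d := tsub_le_iff_left.2 (h _ hs)

lemma setLIntegral_Ioi_eq_top_of_not_ac {μ ν : Measure Z} {δ : ℝ → ℝ≥0∞}
    (hac : ¬ μ ≪ ν)
    (h : ∀ ε : ℝ, 0 < ε → ∀ s, MeasurableSet s →
      μ s ≤ ENNReal.ofReal (Real.exp ε) * ν s + δ ε) :
    ∫⁻ ε in Set.Ioi (0 : ℝ), δ ε = ∞ := by
  obtain ⟨s, hs, hν, hμ⟩ : ∃ s, MeasurableSet s ∧ ν s = 0 ∧ μ s ≠ 0 := by
    by_contra! hall
    exact hac (.mk hall)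
  refine top_le_iff.1 ?_
  calc ∞ = ∫⁻ _ in Set.Ioi (0 : ℝ), μ s := by
        rw [setLIntegral_const, Real.volume_Ioi, ENNReal.mul_top hμ]
    _ ≤ ∫⁻ ε in Set.Ioi (0 : ℝ), δ ε := setLIntegral_mono' measurableSet_Ioi fun ε hε => by
        simpa [hν] using h ε hε s hs

variable {μ ν : Measure Z} [IsFiniteMeasure μ] [IsFiniteMeasure ν]

lemma lintegral_rnDeriv_tsub_le (hac : μ ≪ ν) {c d : ℝ≥0∞} (hc : c ≠ ∞)
    (h : ∀ s, MeasurableSet s → μ s ≤ c * ν s + d) : ∫⁻ z, μ.rnDeriv ν z - c ∂ν ≤ d := by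
  refine lintegral_tsub_le (Measure.measurable_rnDeriv μ ν) measurable_const ?_ fun s hs => ?_
  · simp [ENNReal.mul_eq_top, hc]
  · rw [Measure.setLIntegral_rnDeriv hac, setLIntegral_const]
    exact h s hs

lemma lintegral_one_tsub_mul_rnDeriv_le (hac : μ ≪ ν) {c d : ℝ≥0∞} (hc : c ≠ ∞)
    (h : ∀ s, MeasurableSet s → ν s ≤ c * μ s + d) :
    ∫⁻ z, 1 - c * μ.rnDeriv ν z ∂ν ≤ d := by
  have hr := Measure.measurable_rnDeriv μ ν
  refine lintegral_tsub_le measurable_const (hr.const_mul c) ?_ fun s hs => ?_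
  · rw [lintegral_const_mul _ hr, Measure.lintegral_rnDeriv hac]
    simp [ENNReal.mul_eq_top, hc]
  · rw [lintegral_const_mul _ hr, Measure.setLIntegral_rnDeriv hac, setLIntegral_const, one_mul]
    exact h s hs

lemma klDiv_le_lintegral_hockeyStickIntegrand (hac : μ ≪ ν) :
    klDiv μ ν ≤ ∫⁻ ε in Set.Ioi (0 : ℝ), ∫⁻ z, hockeyStickIntegrand (μ.rnDeriv ν z) ε ∂ν := by
  have hmeas : Measurable (Function.uncurry fun z ε =>
      hockeyStickIntegrand (μ.rnDeriv ν z) ε) := by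
    unfold Function.uncurry hockeyStickIntegrand
    fun_prop
  rw [klDiv_eq_lintegral_klFun_of_ac hac, ← lintegral_lintegral_swap hmeas.aemeasurable]
  refine lintegral_mono_ae ?_
  filter_upwards [μ.rnDeriv_ne_top ν] with z hz using ofReal_klFun_toReal_le hz

lemma klDiv_le_lintegral {δ : ℝ → ℝ≥0∞}
    (hμν : ∀ ε : ℝ, 0 < ε → ∀ s, MeasurableSet s →
      μ s ≤ ENNReal.ofReal (Real.exp ε) * ν s + δ ε)
    (hνμ : ∀ ε : ℝ, 0 < ε → ∀ s, MeasurableSet s →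
      ν s ≤ ENNReal.ofReal (Real.exp ε) * μ s + δ ε) :
    klDiv μ ν ≤ ∫⁻ ε in Set.Ioi (0 : ℝ), (1 + ENNReal.ofReal (Real.exp (-ε))) * δ ε := by
  by_cases hac : μ ≪ ν
  · refine (klDiv_le_lintegral_hockeyStickIntegrand hac).trans
      (setLIntegral_mono' measurableSet_Ioi fun ε hε => ?_)
    unfold hockeyStickIntegrand
    rw [lintegral_add_left (by fun_prop), lintegral_const_mul _ (by fun_prop), add_mul, one_mul]
    gcongr
    · exact lintegral_rnDeriv_tsub_le hac ENNReal.ofReal_ne_top (hμν ε hε)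
    · exact lintegral_one_tsub_mul_rnDeriv_le hac ENNReal.ofReal_ne_top (hνμ ε hε)
  · calc klDiv μ ν ≤ ∫⁻ ε in Set.Ioi (0 : ℝ), δ ε :=
          (setLIntegral_Ioi_eq_top_of_not_ac hac hμν).ge.trans' le_top
      _ ≤ _ := lintegral_mono fun ε => le_mul_of_one_le_left' le_self_add

end HockeyStick

section Converse

variable {X Y : Type*} [MeasurableSpace X] [MeasurableSpace Y]

lemma lintegral_mul_add_const (P : Measure X) [IsProbabilityMeasure P] {f : X → ℝ≥0∞}
    (hf : Measurable f) (c d : ℝ≥0∞) : ∫⁻ x, c * f x + d ∂P = c * ∫⁻ x, f x ∂P + d := by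
  rw [lintegral_add_right _ measurable_const, lintegral_const_mul _ hf, lintegral_const,
    measure_univ, mul_one]

section Indistinguishable

variable {M : Kernel X Y} {c d : ℝ≥0∞} (P : Measure X) [IsProbabilityMeasure P]

lemma apply_le_comp_of_forall_le {s : Set Y} (hs : MeasurableSet s) {x : X}
    (h : ∀ x', M x s ≤ c * M x' s + d) : M x s ≤ c * (M ∘ₘ P) s + d := by
  rw [Measure.bind_apply hs M.aemeasurable, ← lintegral_mul_add_const P (M.measurable_coe hs)]
  calc M x s = ∫⁻ _, M x s ∂P := by rw [lintegral_const, measure_univ, mul_one]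
    _ ≤ _ := lintegral_mono h

lemma comp_le_apply_of_forall_le {s : Set Y} (hs : MeasurableSet s) {x : X}
    (h : ∀ x', M x' s ≤ c * M x s + d) : (M ∘ₘ P) s ≤ c * M x s + d := by
  rw [Measure.bind_apply hs M.aemeasurable]
  calc ∫⁻ x', M x' s ∂P ≤ ∫⁻ _, (c * M x s + d) ∂P := lintegral_mono h
    _ = _ := by rw [lintegral_const, measure_univ, mul_one]

variable [IsSFiniteKernel M]

lemma compProd_le_prod_of_forall_le (h : ∀ x x' s, MeasurableSet s → M x s ≤ c * M x' s + d)
    {s : Set (X × Y)} (hs : MeasurableSet s) :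
    (P ⊗ₘ M) s ≤ c * (P.prod (M ∘ₘ P)) s + d := by
  rw [Measure.compProd_apply hs, Measure.prod_apply hs,
    ← lintegral_mul_add_const P (measurable_measure_prodMk_left hs)]
  refine lintegral_mono fun x => ?_
  have hsec := measurable_prodMk_left (x := x) hs
  exact apply_le_comp_of_forall_le P hsec fun x' => h x x' _ hsec

lemma prod_le_compProd_of_forall_le (h : ∀ x x' s, MeasurableSet s → M x s ≤ c * M x' s + d)
    {s : Set (X × Y)} (hs : MeasurableSet s) :
    (P.prod (M ∘ₘ P)) s ≤ c * (P ⊗ₘ M) s + d := by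
  rw [Measure.compProd_apply hs, Measure.prod_apply hs,
    ← lintegral_mul_add_const P (Kernel.measurable_kernel_prodMk_left hs)]
  refine lintegral_mono fun x => ?_
  have hsec := measurable_prodMk_left (x := x) hs
  exact comp_le_apply_of_forall_le P hsec fun x' => h x' x _ hsec

end Indistinguishable

lemma IsLDP.apply_le {ε δ : ℝ} {M : Kernel X Y} [IsFiniteKernel M] (h : IsLDP ε δ M) (x x' : X)
    (s : Set Y) (hs : MeasurableSet s) :
    M x s ≤ ENNReal.ofReal (Real.exp ε) * M x' s + ENNReal.ofReal δ := by
  calc M x s = ENNReal.ofReal ((M x).real s) := by rw [ofReal_measureReal]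
    _ ≤ ENNReal.ofReal (Real.exp ε * (M x').real s + δ) := ENNReal.ofReal_le_ofReal (h x x' s hs)
    _ ≤ ENNReal.ofReal (Real.exp ε * (M x').real s) + ENNReal.ofReal δ := ENNReal.ofReal_add_le
    _ = _ := by rw [ENNReal.ofReal_mul (Real.exp_pos ε).le, ofReal_measureReal]

lemma muCI_eq (δ : ℝ → ℝ) :
    muCI δ = (∫⁻ ε in Set.Ioi (0 : ℝ), (1 + ENNReal.ofReal (Real.exp (-ε))) * ENNReal.ofReal (δ ε))
      / ENNReal.ofReal (Real.log 2) := by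
  rw [muCI, Real.logb, Real.log_exp, one_div, ENNReal.ofReal_inv_of_pos (Real.log_pos one_lt_two),
    mul_comm, ← div_eq_mul_inv]
  congr 2 with ε
  rw [ENNReal.ofReal_mul (by positivity), ENNReal.ofReal_add zero_le_one (Real.exp_pos _).le,
    ENNReal.ofReal_one]

lemma isCILMIP_muCI (𝓓 : Set (ProbabilityMeasure X)) (δ : ℝ → ℝ) (M : Kernel X Y)
    [IsMarkovKernel M] (h : ∀ ε : ℝ, 0 < ε → IsLDP ε (δ ε) M) : IsCILMIP 𝓓 (muCI δ) M := by
  refine iSup₂_le fun P _ => ?_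
  rw [mutualInfo, muCI_eq]
  gcongr
  exact klDiv_le_lintegral
    (fun ε hε _ => compProd_le_prod_of_forall_le _ (h ε hε).apply_le)
    (fun ε hε _ => prod_le_compProd_of_forall_le _ (h ε hε).apply_le)

end Converse

end LocalPrivacy

theorem theorem1 {X Y : Type*} [MeasurableSpace X] [MeasurableSpace Y]
    (𝓓 : Set (ProbabilityMeasure X)) :
    -- the capacity of the binary asymmetric channel in closed form
    (∀ a b : I,
      ((a : ℝ) ≤ min (b : ℝ) (min (1 - b) (1 / 2)) → (a : ℝ) + b ≠ 1 →
        LocalPrivacy.bacCapacity a b ≠ ∞ ∧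
          (LocalPrivacy.bacCapacity a b).toReal = LocalPrivacy.bacFormula a b) ∧
      ((a : ℝ) + b = 1 → LocalPrivacy.bacCapacity a b = 0) ∧
      (b < a → LocalPrivacy.bacCapacity a b = LocalPrivacy.bacCapacity b a) ∧
      (σ b < a → LocalPrivacy.bacCapacity a b = LocalPrivacy.bacCapacity (σ b) (σ a)) ∧
      (1 / 2 < (a : ℝ) →
        LocalPrivacy.bacCapacity a b = LocalPrivacy.bacCapacity (σ a) (σ b))) ∧
    -- (a), the maximum that defines `δ^LDP_μ(ε)` is attained
    (∀ (μ : ℝ≥0∞) (ε : ℝ), 0 < ε →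
      IsGreatest (LocalPrivacy.ldpValues μ ε) (LocalPrivacy.deltaLDP μ ε)) ∧
    -- (a), conversion
    (LocalPrivacy.ContainsTwoPoint 𝓓 →
      ∀ (μ : ℝ≥0∞) (M : Kernel X Y) [IsMarkovKernel M], LocalPrivacy.IsCILMIP 𝓓 μ M →
        ∀ ε : ℝ, 0 < ε → LocalPrivacy.IsLDP ε (LocalPrivacy.deltaLDP μ ε) M) ∧
    -- (a), tightness: a Bernoulli mechanism whose smallest admissible `δ` is `δ^LDP_μ(ε)`
    (∀ (A : Set X) (hA : MeasurableSet A), A.Nonempty → Aᶜ.Nonempty →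
      ∀ (μ : ℝ≥0∞) (ε : ℝ), 0 < ε →
        ∃ p₀ p₁ : I,
          LocalPrivacy.bacCapacity p₀ (σ p₁) ≤ μ ∧
          LocalPrivacy.ldpObjective ε p₀ p₁ = LocalPrivacy.deltaLDP μ ε ∧
          IsMarkovKernel (LocalPrivacy.berMechanism hA p₀ p₁) ∧
          LocalPrivacy.IsCILMIP 𝓓 μ (LocalPrivacy.berMechanism hA p₀ p₁) ∧
          ∀ δ : ℝ, LocalPrivacy.IsLDP ε δ (LocalPrivacy.berMechanism hA p₀ p₁) ↔
            LocalPrivacy.deltaLDP μ ε ≤ δ) ∧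
    -- (b)
    (∀ (δ : ℝ → ℝ) (M : Kernel X Y) [IsMarkovKernel M],
      (∀ ε : ℝ, 0 < ε → LocalPrivacy.IsLDP ε (δ ε) M) →
        LocalPrivacy.IsCILMIP 𝓓 (LocalPrivacy.muCI δ) M) := by
  refine ⟨fun a b => ⟨fun h hab => ?_, LocalPrivacy.bacCapacity_eq_zero,
      fun _ => LocalPrivacy.bacCapacity_swap a b, fun _ => ?_,
      fun _ => (LocalPrivacy.bacCapacity_symm_symm a b).symm⟩,
    fun μ ε _ => LocalPrivacy.isGreatest_deltaLDP μ ε,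
    fun h𝓓 μ M _ hM ε _ => LocalPrivacy.isLDP_of_isCILMIP h𝓓 hM ε,
    fun A hA hA1 hA0 μ ε hε => ?_,
    fun δ M _ h => LocalPrivacy.isCILMIP_muCI 𝓓 δ M h⟩
  · have hle : (a : ℝ) ≤ 1 - b := h.trans ((min_le_right _ _).trans (min_le_left _ _))
    have hlt : (a : ℝ) + b < 1 := lt_of_le_of_ne (by linarith) hab
    rw [LocalPrivacy.bacCapacity_eq_bacFormula hlt]
    exact ⟨ENNReal.ofReal_ne_top,
      ENNReal.toReal_ofReal (LocalPrivacy.bacFormula_nonneg a.2.1 b.2.1 hlt)⟩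
  · rw [LocalPrivacy.bacCapacity_symm_symm, LocalPrivacy.bacCapacity_swap]
  · obtain ⟨p₀, p₁, hp, hmax⟩ := (LocalPrivacy.isGreatest_deltaLDP μ ε).1
    refine ⟨p₀, p₁, hp, hmax.symm, inferInstance,
      iSup₂_le fun P _ => (LocalPrivacy.mutualInfo_berMechanism_le _ hA p₀ p₁).trans hp,
      fun δ => ?_⟩
    rw [LocalPrivacy.isLDP_berMechanism_iff hA hA1 hA0 hε.le,
      LocalPrivacy.max_ldpObjective_symm_eq_deltaLDP hp hmax.symm]
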